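/- Let $M_k$ denote the algebra of complex $k\times k$ matrices, and let $\phi\colon M_m\to M_n$ be a positive linear map, i.e. a complex-linear map sending positive semi-definite matrices to positive semi-definite matrices. Let $\mathbb P_1$ be the convex cone of all positive linear maps from $M_m$ to $M_n$, and let $\langle\cdot,\cdot\rangle$ be the bilinear pairing between $M_n\otimes M_m$ and the space of linear maps from $M_m$ to $M_n$ determined by $\langle y\otimes x,\psi\rangle=\operatorname{Tr}(\psi(x)y^{\mathrm t})$. Let $\mathbb P_1^\circ=\{A\in M_n\otimes M_m:\langle A,\psi\rangle\ge 0\text{ for all }\psi\in\mathbb P_1\}$ be the dual cone (which is the cone of separable matrices), let $L_\phi=\{c\phi:c\ge 0\}$, and let $$L_\phi'=\{A\in\mathbb P_1^\circ:\langle A,\psi\rangle=0\text{ for all }\psi\in L_\phi\}$$ be the dual face. Let $\mathbb T$ be the convex cone of all positive semi-definite $A\in M_n\otimes M_m$ whose partial transpose $A^\tau$ is positive semi-definite, where $(y\otimes x)^\tau=y\otimes x^{\mathrm t}$. Let $P_\phi$ be the set of all product vectors $\bar y\otimes x\in\mathbb C^n\otimes\mathbb C^m$ with $y^*\phi(xx^*)y=0$;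 the partial conjugate of $\bar y\otimes x$ is $\bar y\otimes\bar x$. For a convex set $C$, let $\operatorname{int}C$ be its interior relative to the real affine subspace that it generates. We say that $L_\phi'$ lies in the interior of $\mathbb T$ if $\operatorname{int}L_\phi'\subseteq\operatorname{int}\mathbb T$. Then $L_\phi'$ lies in the interior of $\mathbb T$ if and only if $P_\phi$ spans $\mathbb C^n\otimes\mathbb C^m$ and the set of partial conjugates of the vectors in $P_\phi$ also spans $\mathbb C^n\otimes\mathbb C^m$. Moreover, suppose that $\phi$ is exposed, i.e. $\phi\neq 0$ and there is a real-linear functional on the space of linear maps from $M_m$ to $M_n$ that is non-negative on $\mathbb P_1$ and whose zero set in $\mathbb P_1$ is exactly $L_\phi$. Then $L_\phi'$ lies in the interior of $\mathbb T$ if and only if $\phi$ is indecomposable, i.e. not a finite sum of maps of the forms $X\mapsto V^*XV$ and $X\mapsto V^*X^{\mathrm t}V$ with $m\times n$ matrices $V$. -/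

import Mathlib

open scoped Matrix Kronecker ComplexOrder

namespace PPTFace

/-- The space `ℒ(M_m, M_n)` of complex-linear maps between full matrix algebras. -/
abbrev MatrixMap (m n : ℕ) : Type :=
  Matrix (Fin m) (Fin m) ℂ →ₗ[ℂ] Matrix (Fin n) (Fin n) ℂ

/-- The matrix algebra `M_n ⊗ M_m`, realised as matrices indexed by `Fin n × Fin m`;
the elementary tensor `y ⊗ x` is the Kronecker product `y ⊗ₖ x`. -/
abbrev BiMatrix (n m : ℕ) : Type :=
  Matrix (Fin n × Fin m) (Fin n × Fin m) ℂ

/-- `φ` is a positive map: it sends positive semi-definite matrices to such matrices. -/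
def IsPositiveMap {m n : ℕ} (φ : MatrixMap m n) : Prop :=
  ∀ X : Matrix (Fin m) (Fin m) ℂ, X.PosSemidef → (φ X).PosSemidef

/-- The cone `ℙ₁` of all positive linear maps from `M_m` to `M_n`. -/
def positiveCone (m n : ℕ) : Set (MatrixMap m n) := {φ | IsPositiveMap φ}

/-- The bilinear pairing between `M_n ⊗ M_m` and `ℒ(M_m, M_n)`, written out in matrix units;
it is characterised by `pairing_kronecker` below. -/
def pairing {m n : ℕ} (A : BiMatrix n m) (φ : MatrixMap m n) : ℂ :=
  ∑ i : Fin n, ∑ j : Fin n, ∑ k : Fin m, ∑ l : Fin m,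
    A (i, k) (j, l) * φ (Matrix.single k l 1) i j

/-- `⟨y ⊗ x, φ⟩ = Tr (φ(x) yᵗ)`. -/
theorem pairing_kronecker {m n : ℕ} (y : Matrix (Fin n) (Fin n) ℂ)
    (x : Matrix (Fin m) (Fin m) ℂ) (φ : MatrixMap m n) :
    pairing (y ⊗ₖ x) φ = (φ x * yᵀ).trace := by
  have hx : φ x = ∑ k : Fin m, ∑ l : Fin m, x k l • φ (Matrix.single k l 1) := by
    conv_lhs => rw [Matrix.matrix_eq_sum_single x]
    simp only [map_sum]
    refine Finset.sum_congr rfl fun k _ => Finset.sum_congr rfl fun l _ => ?_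
    rw [← map_smul, Matrix.smul_single, smul_eq_mul, mul_one]
  have hx' : ∀ i j, φ x i j = ∑ k : Fin m, ∑ l : Fin m, x k l * φ (Matrix.single k l 1) i j := by
    intro i j
    conv_lhs => rw [hx]
    simp only [Matrix.sum_apply, Matrix.smul_apply, smul_eq_mul]
  simp only [pairing, Matrix.trace, Matrix.diag_apply, Matrix.mul_apply, Matrix.transpose_apply,
    Matrix.kroneckerMap_apply, hx', Finset.sum_mul]
  refine Finset.sum_congr rfl fun i _ => Finset.sum_congr rfl fun j _ =>
    Finset.sum_congr rfl fun k _ => Finset.sum_congr rfl fun l _ => ?_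
  ring

/-- The dual cone `C° = {A : ⟨A, ψ⟩ ≥ 0 for each ψ ∈ C}` of a set `C` of maps
(`0 ≤ z` for a complex number `z` says that `z` is real and non-negative). -/
def dualCone {m n : ℕ} (C : Set (MatrixMap m n)) : Set (BiMatrix n m) :=
  {A | ∀ ψ ∈ C, 0 ≤ pairing A ψ}

/-- For a subset `F` of the cone `C`, the dual face
`F′ = {A ∈ C° : ⟨A, ψ⟩ = 0 for each ψ ∈ F}`. -/
def dualFace {m n : ℕ} (C F : Set (MatrixMap m n)) : Set (BiMatrix n m) :=
  {A | A ∈ dualCone C ∧ ∀ ψ ∈ F, pairing A ψ = 0}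

/-- The ray `{c x : c ≥ 0}` generated by `x`. -/
def ray {E : Type*} [AddCommGroup E] [Module ℝ E] (x : E) : Set E :=
  {z | ∃ c : ℝ, 0 ≤ c ∧ z = c • x}

/-- `x` generates an exposed ray of the convex cone `C` (in a finite-dimensional real space):
`x` is a nonzero element of `C`, and the ray through `x` is the set where some linear functional
which is non-negative on `C` vanishes on `C`. -/
def GeneratesExposedRay {E : Type*} [AddCommGroup E] [Module ℝ E] (C : Set E) (x : E) : Prop :=
  x ∈ C ∧ x ≠ 0 ∧
    ∃ f : E →ₗ[ℝ] ℝ, (∀ z ∈ C, 0 ≤ f z) ∧ {z | z ∈ C ∧ f z = 0} = ray x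

/-- `φ` is exposed: it generates an exposed ray of the cone of positive maps. -/
def IsExposedMap {m n : ℕ} (φ : MatrixMap m n) : Prop :=
  GeneratesExposedRay (positiveCone m n) φ

/-- The partial transpose of a matrix in `M_n ⊗ M_m`, with `(y ⊗ x)^τ = y ⊗ xᵗ`. -/
def partialTranspose {n m : ℕ} (A : BiMatrix n m) : BiMatrix n m :=
  Matrix.of fun p q => A (p.1, q.2) (q.1, p.2)

/-- The cone `𝕋` of positive semi-definite matrices in `M_n ⊗ M_m` whose partial transposes are
positive semi-definite. -/
def pptCone (n m : ℕ) : Set (BiMatrix n m) :=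
  {A | A.PosSemidef ∧ (partialTranspose A).PosSemidef}

/-- The product vector `u ⊗ v` in `ℂⁿ ⊗ ℂᵐ`. -/
def productVector {n m : ℕ} (u : Fin n → ℂ) (v : Fin m → ℂ) : Fin n × Fin m → ℂ :=
  fun p => u p.1 * v p.2

/-- `(φ(x x*) y | y) = y* φ(x x*) y`. -/
def quadForm {m n : ℕ} (φ : MatrixMap m n) (x : Fin m → ℂ) (y : Fin n → ℂ) : ℂ :=
  star y ⬝ᵥ (φ (Matrix.vecMulVec x (star x)) *ᵥ y)

/-- `P_φ`: the product vectors `ȳ ⊗ x` with `(φ(x x*) y | y) = 0`. -/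
def productZeros {m n : ℕ} (φ : MatrixMap m n) : Set (Fin n × Fin m → ℂ) :=
  {z | ∃ (x : Fin m → ℂ) (y : Fin n → ℂ), quadForm φ x y = 0 ∧ z = productVector (star y) x}

/-- The partial conjugates `ȳ ⊗ x̄` of the product vectors `ȳ ⊗ x` in `P_φ`. -/
def productZerosConj {m n : ℕ} (φ : MatrixMap m n) : Set (Fin n × Fin m → ℂ) :=
  {z | ∃ (x : Fin m → ℂ) (y : Fin n → ℂ),
    productVector (star y) x ∈ productZeros φ ∧ z = productVector (star y) (star x)}

/-- The completely positive map `X ↦ V* X V`. -/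
def conjMap {m n : ℕ} (V : Matrix (Fin m) (Fin n) ℂ) : MatrixMap m n where
  toFun X := Vᴴ * X * V
  map_add' X Y := by rw [Matrix.mul_add, Matrix.add_mul]
  map_smul' c X := by simp

/-- The completely copositive map `X ↦ V* Xᵗ V`. -/
def coconjMap {m n : ℕ} (V : Matrix (Fin m) (Fin n) ℂ) : MatrixMap m n where
  toFun X := Vᴴ * Xᵀ * V
  map_add' X Y := by rw [Matrix.transpose_add, Matrix.mul_add, Matrix.add_mul]
  map_smul' c X := by simp

/-- `φ` is decomposable: a finite sum of maps `X ↦ V* X V` and `X ↦ W* Xᵗ W`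
(non-negative coefficients are absorbed into `V` and `W`). -/
def IsDecomposable {m n : ℕ} (φ : MatrixMap m n) : Prop :=
  ∃ (r s : ℕ) (V : Fin r → Matrix (Fin m) (Fin n) ℂ) (W : Fin s → Matrix (Fin m) (Fin n) ℂ),
    φ = ∑ i, conjMap (V i) + ∑ j, coconjMap (W j)

/-- `φ` is an indecomposable positive map. -/
def IsIndecomposable {m n : ℕ} (φ : MatrixMap m n) : Prop :=
  IsPositiveMap φ ∧ ¬ IsDecomposable φ

/-- A convex set `F` lies in the interior of a convex set `K`: the (relative) interior of `F` is
contained in the (relative) interior of `K`, both taken in the respective real affine hulls. -/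
def LiesInInterior {n m : ℕ} (F K : Set (BiMatrix n m)) : Prop :=
  intrinsicInterior ℝ F ⊆ intrinsicInterior ℝ K

end PPTFace

open PPTFace

/-! Everything is read off from pairings with elementary maps. If `V = unvec w`, then `⟨A, X ↦ V* X
V⟩ = w* A w` and `⟨A, X ↦ V* Xᵗ V⟩ = w* A^τ w`. A matrix is relatively interior to `𝕋` exactly when
`A` and `A^τ` are positive definite, and a positive map orthogonal to one relative interior point of
a dual face is orthogonal to the whole face. Hence the face lies in the interior of `𝕋` iff it is
orthogonal to no nonzero elementary map (`liesInInterior_dualFace_iff`).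

Orthogonality of a positive map `ψ` to `L_φ′` means that its quadratic form vanishes wherever that
of `φ` does. Necessity uses the rank-one matrices of vectors in `P_φ`. Sufficiency
(`pairing_eq_zero_of_quadForm`) is a compactness argument, `ψ ≤ C φ + ε Tr(·) 1`, which needs no
decomposition of dual-cone elements into product states. For elementary maps the form is `|w* z|²`
with `z` the product vector or its partial conjugate, so the criterion becomes the two spanning
conditions.

If `φ` is exposed, the positive maps orthogonal to `L_φ′` are just the ray of `φ`
(`IsExposedMap.mem_ray`); an elementary one would make `φ` decomposable. Conversely, the summands of
a decomposable `φ` are all orthogonal to `L_φ′`, so if the face is interior they vanish and `φ = 0`.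
-/

namespace PPTFace

/-! ### The pairing on elementary maps and product vectors -/

/-- Over `ℂ` hermiticity follows from non-negativity of the quadratic form. -/
theorem posSemidef_of_dotProduct_nonneg {ι : Type*} [Fintype ι] [DecidableEq ι]
    {B : Matrix ι ι ℂ} (h : ∀ z : ι → ℂ, 0 ≤ star z ⬝ᵥ (B *ᵥ z)) : B.PosSemidef := by
  rw [← Matrix.isPositive_toEuclideanLin_iff, LinearMap.isPositive_iff_complex]
  intro z
  have hz := h z.ofLp
  have e : inner ℂ (Matrix.toEuclideanLin B z) z = star (star z.ofLp ⬝ᵥ (B *ᵥ z.ofLp)) := by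
    rw [EuclideanSpace.inner_eq_star_dotProduct, ← Matrix.star_dotProduct_star, star_star]
    simp [Matrix.toLpLin_apply, dotProduct_comm]
  rw [e, (IsSelfAdjoint.of_nonneg hz).star_eq]
  rw [Complex.nonneg_iff] at hz
  refine ⟨?_, hz.1⟩
  apply Complex.ext <;> simp [← hz.2]

theorem pairing_add_right {m n : ℕ} (A : BiMatrix n m) (φ ψ : MatrixMap m n) :
    pairing A (φ + ψ) = pairing A φ + pairing A ψ := by
  simp [pairing, mul_add, Finset.sum_add_distrib]

theorem pairing_sub_right {m n : ℕ} (A : BiMatrix n m) (φ ψ : MatrixMap m n) :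
    pairing A (φ - ψ) = pairing A φ - pairing A ψ := by
  simp [pairing, mul_sub, Finset.sum_sub_distrib]

theorem pairing_smul_right {m n : ℕ} (A : BiMatrix n m) (c : ℝ) (φ : MatrixMap m n) :
    pairing A (c • φ) = c * pairing A φ := by
  simp [pairing, Finset.mul_sum, mul_left_comm]

theorem pairing_zero_right {m n : ℕ} (A : BiMatrix n m) :
    pairing A (0 : MatrixMap m n) = 0 := by
  simp [pairing]

theorem pairing_sum_right {m n : ℕ} {ι : Type*} (s : Finset ι) (A : BiMatrix n m)
    (f : ι → MatrixMap m n) : pairing A (∑ i ∈ s, f i) = ∑ i ∈ s, pairing A (f i) :=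
  map_sum (AddMonoidHom.mk' (pairing A) (pairing_add_right A)) f s

theorem pairing_add_left {m n : ℕ} (A B : BiMatrix n m) (φ : MatrixMap m n) :
    pairing (A + B) φ = pairing A φ + pairing B φ := by
  simp [pairing, add_mul, Finset.sum_add_distrib]

theorem pairing_sub_left {m n : ℕ} (A B : BiMatrix n m) (φ : MatrixMap m n) :
    pairing (A - B) φ = pairing A φ - pairing B φ := by
  simp [pairing, sub_mul, Finset.sum_sub_distrib]

theorem pairing_smul_left {m n : ℕ} (c : ℝ) (A : BiMatrix n m) (φ : MatrixMap m n) :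
    pairing (c • A) φ = c * pairing A φ := by
  simp [pairing, Finset.mul_sum, mul_assoc]

/-- The matrix `V` with `V k i = w (i, k)`. -/
def unvec {m n : ℕ} (w : Fin n × Fin m → ℂ) : Matrix (Fin m) (Fin n) ℂ :=
  Matrix.of fun k i => w (i, k)

theorem quad_eq_sum {m n : ℕ} (A : BiMatrix n m) (w : Fin n × Fin m → ℂ) :
    star w ⬝ᵥ (A *ᵥ w) = ∑ i : Fin n, ∑ j : Fin n, ∑ k : Fin m, ∑ l : Fin m,
      A (i, k) (j, l) * (star (w (i, k)) * w (j, l)) := by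
  simp only [dotProduct, Matrix.mulVec, Fintype.sum_prod_type, Finset.mul_sum, Pi.star_apply]
  refine Finset.sum_congr rfl fun i _ => ?_
  rw [Finset.sum_comm]
  refine Finset.sum_congr rfl fun j _ => Finset.sum_congr rfl fun k _ =>
    Finset.sum_congr rfl fun l _ => ?_
  ring

theorem pairing_conjMap {m n : ℕ} (A : BiMatrix n m) (w : Fin n × Fin m → ℂ) :
    pairing A (conjMap (unvec w)) = star w ⬝ᵥ (A *ᵥ w) := by
  rw [quad_eq_sum, pairing]
  refine Finset.sum_congr rfl fun i _ => Finset.sum_congr rfl fun j _ =>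
    Finset.sum_congr rfl fun k _ => Finset.sum_congr rfl fun l _ => ?_
  congr 1
  simp [conjMap, unvec, Matrix.mul_apply, Matrix.single_apply, ite_and]

theorem pairing_coconjMap {m n : ℕ} (A : BiMatrix n m) (w : Fin n × Fin m → ℂ) :
    pairing A (coconjMap (unvec w)) = star w ⬝ᵥ (partialTranspose A *ᵥ w) := by
  rw [quad_eq_sum, pairing]
  refine Finset.sum_congr rfl fun i _ => Finset.sum_congr rfl fun j _ => ?_
  rw [Finset.sum_comm]
  refine Finset.sum_congr rfl fun k _ => Finset.sum_congr rfl fun l _ => ?_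
  congr 1
  simp [coconjMap, unvec, Matrix.mul_apply, Matrix.single_apply, ite_and]

/-- The trace map `X ↦ Tr(X) 1`. -/
def traceMap (m n : ℕ) : MatrixMap m n where
  toFun X := X.trace • 1
  map_add' X Y := by simp [add_smul]
  map_smul' c X := by simp [mul_smul]

theorem pairing_traceMap {m n : ℕ} (A : BiMatrix n m) :
    pairing A (traceMap m n) = A.trace := by
  simp only [pairing, traceMap, LinearMap.coe_mk, AddHom.coe_mk, Matrix.smul_apply, Matrix.trace,
    Matrix.diag_apply, Fintype.sum_prod_type, Matrix.single_apply, Matrix.one_apply, ite_and]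
  simp

/-- Rank-one matrices at product vectors represent the quadratic form. -/
theorem pairing_vecMulVec {m n : ℕ} (φ : MatrixMap m n) (x : Fin m → ℂ) (y : Fin n → ℂ) :
    pairing (Matrix.vecMulVec (productVector (star y) x) (star (productVector (star y) x))) φ
      = quadForm φ x y := by
  -- The conjugate on `y` cancels the transpose in `Tr (φ(x) yᵗ)`.
  have e : Matrix.vecMulVec (productVector (star y) x) (star (productVector (star y) x))
      = Matrix.vecMulVec (star y) y ⊗ₖ Matrix.vecMulVec x (star x) := by
    ext p q
    simp [Matrix.vecMulVec_apply, productVector]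
    ring
  rw [e, pairing_kronecker, Matrix.transpose_vecMulVec, Matrix.mul_vecMulVec,
    Matrix.trace_vecMulVec, quadForm, dotProduct_comm]

theorem quad_vecMulVec {ι : Type*} [Fintype ι] (w z : ι → ℂ) :
    star w ⬝ᵥ (Matrix.vecMulVec z (star z) *ᵥ w) = Complex.normSq (star w ⬝ᵥ z) := by
  rw [Matrix.vecMulVec_mulVec, dotProduct_smul, ← Complex.mul_conj, starRingEnd_apply,
    Matrix.star_dotProduct]
  simp [dotProduct_comm]

theorem partialTranspose_vecMulVec {m n : ℕ} (u : Fin n → ℂ) (v : Fin m → ℂ) :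
    partialTranspose (Matrix.vecMulVec (productVector u v) (star (productVector u v)))
      = Matrix.vecMulVec (productVector u (star v)) (star (productVector u (star v))) := by
  ext p q
  simp [partialTranspose, Matrix.vecMulVec_apply, productVector]
  ring

-- A positive semi-definite `X = B* B` is a sum of rank-one terms built from the rows of `B`.
open scoped MatrixOrder Matrix.Norms.L2Operator in
theorem isPositiveMap_of_quadForm {m n : ℕ} {ψ : MatrixMap m n}
    (h : ∀ x y, 0 ≤ quadForm ψ x y) : IsPositiveMap ψ := by
  intro X hX
  obtain ⟨B, rfl⟩ := CStarAlgebra.nonneg_iff_eq_star_mul_self.mp hX.nonneg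
  rw [Matrix.star_eq_conjTranspose]
  have e : Bᴴ * B = ∑ r, Matrix.vecMulVec (star (B r)) (star (star (B r))) := by
    ext i j
    simp [Matrix.mul_apply, Matrix.sum_apply, Matrix.vecMulVec_apply]
  rw [e, map_sum]
  exact Matrix.posSemidef_sum _ fun r _ => posSemidef_of_dotProduct_nonneg fun z => h _ z

theorem IsPositiveMap.quadForm_nonneg {m n : ℕ} {ψ : MatrixMap m n} (h : IsPositiveMap ψ)
    (x : Fin m → ℂ) (y : Fin n → ℂ) : 0 ≤ quadForm ψ x y :=
  (h _ (Matrix.posSemidef_vecMulVec_self_star x)).dotProduct_mulVec_nonneg y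

theorem isPositiveMap_conjMap {m n : ℕ} (V : Matrix (Fin m) (Fin n) ℂ) :
    IsPositiveMap (conjMap V) := fun _ hX => hX.conjTranspose_mul_mul_same V

theorem isPositiveMap_coconjMap {m n : ℕ} (V : Matrix (Fin m) (Fin n) ℂ) :
    IsPositiveMap (coconjMap V) := fun _ hX => hX.transpose.conjTranspose_mul_mul_same V

theorem quadForm_conjMap {m n : ℕ} (w : Fin n × Fin m → ℂ) (x : Fin m → ℂ) (y : Fin n → ℂ) :
    quadForm (conjMap (unvec w)) x y
      = Complex.normSq (star w ⬝ᵥ productVector (star y) x) := by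
  rw [← pairing_vecMulVec, pairing_conjMap, quad_vecMulVec]

theorem quadForm_coconjMap {m n : ℕ} (w : Fin n × Fin m → ℂ) (x : Fin m → ℂ) (y : Fin n → ℂ) :
    quadForm (coconjMap (unvec w)) x y
      = Complex.normSq (star w ⬝ᵥ productVector (star y) (star x)) := by
  rw [← pairing_vecMulVec, pairing_coconjMap, partialTranspose_vecMulVec, quad_vecMulVec]

theorem quadForm_traceMap {m n : ℕ} (x : Fin m → ℂ) (y : Fin n → ℂ) :
    quadForm (traceMap m n) x y = (x ⬝ᵥ star x) * (star y ⬝ᵥ y) := by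
  simp [quadForm, traceMap, Matrix.trace_vecMulVec, Matrix.smul_mulVec]

theorem dualCone_subset_pptCone {m n : ℕ} : dualCone (positiveCone m n) ⊆ pptCone n m := by
  intro A hA
  constructor <;> refine posSemidef_of_dotProduct_nonneg fun w => ?_
  · rw [← pairing_conjMap]
    exact hA _ (isPositiveMap_conjMap _)
  · rw [← pairing_coconjMap]
    exact hA _ (isPositiveMap_coconjMap _)

theorem vecMulVec_mem_dualFace {m n : ℕ} {φ : MatrixMap m n} {x : Fin m → ℂ} {y : Fin n → ℂ}
    (h : quadForm φ x y = 0) :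
    Matrix.vecMulVec (productVector (star y) x) (star (productVector (star y) x))
      ∈ dualFace (positiveCone m n) (ray φ) := by
  refine ⟨fun ψ hψ => ?_, ?_⟩
  · rw [pairing_vecMulVec]
    exact IsPositiveMap.quadForm_nonneg hψ x y
  · rintro _ ⟨c, -, rfl⟩
    rw [pairing_smul_right, pairing_vecMulVec, h, mul_zero]

/-- A product vector factors in many ways, but the form depends only on its rank-one matrix, hence
not on the factors. -/
theorem mem_productZeros_iff {m n : ℕ} {φ : MatrixMap m n} (x : Fin m → ℂ) (y : Fin n → ℂ) :
    productVector (star y) x ∈ productZeros φ ↔ quadForm φ x y = 0 := by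
  refine ⟨?_, fun h => ⟨x, y, h, rfl⟩⟩
  rintro ⟨x', y', h, e⟩
  rw [← pairing_vecMulVec, e, pairing_vecMulVec, h]

/-! ### Relative interior of `𝕋` -/

open Filter Topology

/-- Every segment ending at a relative interior point can be prolonged inside the set. -/
theorem exists_prolong_of_mem_intrinsicInterior {E : Type*} [AddCommGroup E] [Module ℝ E]
    [TopologicalSpace E] [ContinuousAdd E] [ContinuousSMul ℝ E] {C : Set E} {a b : E}
    (ha : a ∈ intrinsicInterior ℝ C) (hb : b ∈ C) :
    ∃ ε : ℝ, 0 < ε ∧ a + ε • (a - b) ∈ C := by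
  obtain ⟨⟨y, hy⟩, hint, rfl⟩ := mem_intrinsicInterior.mp ha
  have hmem : ∀ t : ℝ, y + t • (y - b) ∈ affineSpan ℝ C := fun t => by
    -- The prolonged point is `b + (1 + t)(y - b)`, on the line through `b` and `y`.
    have := AffineMap.lineMap_mem (1 + t) (subset_affineSpan ℝ C hb) hy
    rw [AffineMap.lineMap_apply] at this
    convert this using 1
    simp only [vsub_eq_sub, vadd_eq_add]
    module
  let γ : ℝ → affineSpan ℝ C := fun t => ⟨y + t • (y - b), hmem t⟩
  have hγ : Continuous γ := by
    refine Continuous.subtype_mk ?_ _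
    fun_prop
  have h0 : γ 0 = ⟨y, hy⟩ := by simp [γ]
  have h1 : ∀ᶠ t in 𝓝 (0 : ℝ), γ t ∈ ((↑) ⁻¹' C : Set (affineSpan ℝ C)) :=
    hγ.continuousAt.eventually (by rw [h0]; exact mem_interior_iff_mem_nhds.mp hint)
  obtain ⟨ε, hε, hε'⟩ := Metric.eventually_nhds_iff.mp h1
  refine ⟨ε / 2, by positivity, hε' (y := ε / 2) ?_⟩
  rw [Real.dist_eq, sub_zero, abs_of_pos (by positivity)]
  linarith

theorem partialTranspose_add {n m : ℕ} (A B : BiMatrix n m) :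
    partialTranspose (A + B) = partialTranspose A + partialTranspose B := rfl

theorem partialTranspose_sub {n m : ℕ} (A B : BiMatrix n m) :
    partialTranspose (A - B) = partialTranspose A - partialTranspose B := rfl

theorem partialTranspose_smul {n m : ℕ} (c : ℝ) (A : BiMatrix n m) :
    partialTranspose (c • A) = c • partialTranspose A := rfl

theorem partialTranspose_one {n m : ℕ} : partialTranspose (1 : BiMatrix n m) = 1 := by
  ext ⟨a, b⟩ ⟨c, d⟩
  simp [partialTranspose, Matrix.one_apply, eq_comm (a := b)]

theorem partialTranspose_isHermitian {n m : ℕ} {A : BiMatrix n m} (h : A.IsHermitian) :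
    (partialTranspose A).IsHermitian := by
  ext p q
  exact h.apply _ _

theorem one_mem_pptCone {n m : ℕ} : (1 : BiMatrix n m) ∈ pptCone n m :=
  ⟨.one, by rw [partialTranspose_one]; exact .one⟩

/-- Hermitian matrices form a real affine subspace. -/
theorem isHermitian_of_mem_affineSpan {ι : Type*} {C : Set (Matrix ι ι ℂ)}
    (hC : ∀ A ∈ C, A.IsHermitian) {A : Matrix ι ι ℂ} (hA : A ∈ affineSpan ℝ C) :
    A.IsHermitian := by
  have h : affineSpan ℝ C ≤ (selfAdjoint.submodule ℝ (Matrix ι ι ℂ)).toAffineSubspace :=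
    affineSpan_le.mpr fun B hB => hC B hB
  exact h hA

/-- Positive definiteness is an open condition among hermitian matrices. -/
theorem eventually_posDef {ι : Type*} [Fintype ι] {A : Matrix ι ι ℂ} (hA : A.PosDef) :
    ∀ᶠ B in 𝓝 A, B.IsHermitian → B.PosDef := by
  have h : ∀ᶠ B in 𝓝 A, ∀ z ∈ Metric.sphere (0 : ι → ℂ) 1, 0 < (star z ⬝ᵥ (B *ᵥ z)).re := by
    refine (isCompact_sphere _ _).eventually_forall_of_forall_eventually fun z hz => ?_
    have hc : Continuous fun p : Matrix ι ι ℂ × (ι → ℂ) => (star p.2 ⬝ᵥ (p.1 *ᵥ p.2)).re := by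
      fun_prop
    refine hc.continuousAt.eventually (lt_mem_nhds ?_)
    have hz0 : z ≠ 0 := by
      rintro rfl
      simp at hz
    exact (Complex.pos_iff.mp (hA.dotProduct_mulVec_pos hz0)).1
  filter_upwards [h] with B hB hH
  refine Matrix.PosDef.of_dotProduct_mulVec_pos hH fun x hx => ?_
  have hn : 0 < ‖x‖ := norm_pos_iff.mpr hx
  have hx' := hB ((‖x‖⁻¹ : ℝ) • x) (by simp [norm_smul, hn.ne'])
  have e : star ((‖x‖⁻¹ : ℝ) • x) ⬝ᵥ (B *ᵥ ((‖x‖⁻¹ : ℝ) • x))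
      = ((‖x‖⁻¹ * ‖x‖⁻¹ : ℝ) : ℂ) * (star x ⬝ᵥ (B *ᵥ x)) := by
    simp [Matrix.mulVec_smul, star_smul, mul_assoc]
  rw [e, Complex.re_ofReal_mul] at hx'
  rw [Complex.pos_iff]
  refine ⟨(mul_pos_iff_of_pos_left (by positivity)).mp hx', ?_⟩
  exact (hH.im_star_dotProduct_mulVec_self x).symm

/-- `A` is a positive combination of `1` and the prolonged point. -/
theorem posDef_of_posSemidef_prolong {ι : Type*} [Fintype ι] [DecidableEq ι] {A : Matrix ι ι ℂ}
    {ε : ℝ} (hε : 0 < ε)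
    (h : (A + ε • (A - 1)).PosSemidef) : A.PosDef := by
  have e : A = (1 + ε)⁻¹ • (ε • (1 : Matrix ι ι ℂ) + (A + ε • (A - 1))) := by
    rw [show ε • (1 : Matrix ι ι ℂ) + (A + ε • (A - 1)) = (1 + ε) • A by module,
      inv_smul_smul₀ (by positivity)]
  rw [e]
  exact ((Matrix.PosDef.one.smul hε).add_posSemidef h).smul (by positivity)

/-- Forward, the segment from `1` is prolonged past `A`. Backward, the affine hull of `𝕋` consists
of hermitian matrices, among which both conditions are open. -/
theorem mem_intrinsicInterior_pptCone {n m : ℕ} {A : BiMatrix n m} :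
    A ∈ intrinsicInterior ℝ (pptCone n m) ↔ A.PosDef ∧ (partialTranspose A).PosDef := by
  constructor
  · intro h
    obtain ⟨ε, hε, h1, h2⟩ := exists_prolong_of_mem_intrinsicInterior h one_mem_pptCone
    rw [partialTranspose_add, partialTranspose_smul, partialTranspose_sub,
      partialTranspose_one] at h2
    exact ⟨posDef_of_posSemidef_prolong hε h1, posDef_of_posSemidef_prolong hε h2⟩
  · rintro ⟨h1, h2⟩
    have hA : A ∈ pptCone n m := ⟨h1.posSemidef, h2.posSemidef⟩
    refine mem_intrinsicInterior.mpr ⟨⟨A, subset_affineSpan ℝ _ hA⟩, ?_, rfl⟩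
    rw [mem_interior_iff_mem_nhds]
    have hc : Continuous (partialTranspose : BiMatrix n m → BiMatrix n m) :=
      continuous_matrix fun p q => continuous_id.matrix_elem _ _
    have key : ∀ᶠ B in 𝓝 A, B.IsHermitian → B ∈ pptCone n m := by
      filter_upwards [eventually_posDef h1, hc.continuousAt.eventually (eventually_posDef h2)]
        with B hB1 hB2 hB
      exact ⟨(hB1 hB).posSemidef, (hB2 (partialTranspose_isHermitian hB)).posSemidef⟩
    have := (continuous_subtype_val (p := fun B => B ∈ affineSpan ℝ (pptCone n m))).continuousAt
      (x := ⟨A, subset_affineSpan ℝ _ hA⟩) |>.eventually key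
    filter_upwards [this] with B hB
    exact hB (isHermitian_of_mem_affineSpan (fun _ h => h.1.1) B.2)

/-! ### Orthogonality to the dual face by compactness -/

/-- On a compact set, a continuous function that vanishes at the zeros of a non-negative continuous
`f` is bounded by a multiple of `f` up to any positive error. -/
theorem exists_mul_bound_of_isCompact {X : Type*} [TopologicalSpace X] {K : Set X}
    (hK : IsCompact K) {f g : X → ℝ} (hf : Continuous f) (hg : Continuous g)
    (hf0 : ∀ p ∈ K, 0 ≤ f p) (hfg : ∀ p ∈ K, f p = 0 → g p = 0) {ε : ℝ} (hε : 0 < ε) :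
    ∃ C : ℝ, 0 ≤ C ∧ ∀ p ∈ K, g p ≤ C * f p + ε := by
  -- Where `g < ε` nothing is needed; on the compact rest `f` has no zero, so `g / f` is bounded.
  have hK' : IsCompact (K ∩ {p | ε ≤ g p}) :=
    hK.inter_right (isClosed_le continuous_const hg)
  have hpos : ∀ p ∈ K ∩ {p | ε ≤ g p}, f p ≠ 0 := fun p hp h0 => by
    have h1 := hfg p hp.1 h0
    have h2 : ε ≤ g p := hp.2
    linarith
  obtain ⟨C, hC⟩ := hK'.bddAbove_image (f := fun p => g p / f p)
    (hg.continuousOn.div hf.continuousOn hpos)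
  refine ⟨max C 0, le_max_right _ _, fun p hp => ?_⟩
  have hfp := hf0 p hp
  rcases le_or_gt ε (g p) with h | h
  · have hf' : 0 < f p := hfp.lt_of_ne' (hpos p ⟨hp, h⟩)
    have h1 : g p / f p ≤ C := hC ⟨p, ⟨hp, h⟩, rfl⟩
    rw [div_le_iff₀ hf'] at h1
    have h2 : C * f p ≤ max C 0 * f p := by gcongr; exact le_max_left _ _
    linarith
  · have : 0 ≤ max C 0 * f p := mul_nonneg (le_max_right _ _) hfp
    linarith

theorem quadForm_add {m n : ℕ} (φ ψ : MatrixMap m n) (x : Fin m → ℂ) (y : Fin n → ℂ) :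
    quadForm (φ + ψ) x y = quadForm φ x y + quadForm ψ x y := by
  simp only [← pairing_vecMulVec, pairing_add_right]

theorem quadForm_sub {m n : ℕ} (φ ψ : MatrixMap m n) (x : Fin m → ℂ) (y : Fin n → ℂ) :
    quadForm (φ - ψ) x y = quadForm φ x y - quadForm ψ x y := by
  simp only [← pairing_vecMulVec, pairing_sub_right]

theorem quadForm_smul {m n : ℕ} (c : ℝ) (φ : MatrixMap m n) (x : Fin m → ℂ) (y : Fin n → ℂ) :
    quadForm (c • φ) x y = c * quadForm φ x y := by
  simp only [← pairing_vecMulVec, pairing_smul_right]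

theorem quadForm_smul_smul {m n : ℕ} (φ : MatrixMap m n) (a b : ℝ) (x : Fin m → ℂ)
    (y : Fin n → ℂ) : quadForm φ (a • x) (b • y) = ((a ^ 2 * b ^ 2 : ℝ) : ℂ) * quadForm φ x y := by
  have e : Matrix.vecMulVec (a • x) (star (a • x))
      = ((a ^ 2 : ℝ) : ℂ) • Matrix.vecMulVec x (star x) := by
    ext i j
    simp [Matrix.vecMulVec_apply]
    ring
  rw [quadForm, e, map_smul]
  simp [quadForm, Matrix.smul_mulVec, Matrix.mulVec_smul, star_smul]
  ring

theorem continuous_quadForm {m n : ℕ} (φ : MatrixMap m n) :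
    Continuous fun p : (Fin m → ℂ) × (Fin n → ℂ) => quadForm φ p.1 p.2 := by
  have h : Continuous φ := LinearMap.continuous_of_finiteDimensional φ
  unfold quadForm
  fun_prop

/-- Positivity may be tested on pairs of unit vectors. -/
theorem isPositiveMap_of_sphere {m n : ℕ} {ψ : MatrixMap m n}
    (h : ∀ p ∈ Metric.sphere (0 : Fin m → ℂ) 1 ×ˢ Metric.sphere (0 : Fin n → ℂ) 1,
      0 ≤ quadForm ψ p.1 p.2) : IsPositiveMap ψ := by
  refine isPositiveMap_of_quadForm fun x y => ?_
  rcases eq_or_ne x 0 with rfl | hx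
  · simp [quadForm]
  rcases eq_or_ne y 0 with rfl | hy
  · simp [quadForm]
  have hx' : ‖x‖ ≠ 0 := norm_ne_zero_iff.mpr hx
  have hy' : ‖y‖ ≠ 0 := norm_ne_zero_iff.mpr hy
  have hs := h (‖x‖⁻¹ • x, ‖y‖⁻¹ • y) ⟨by simp [norm_smul, hx'], by simp [norm_smul, hy']⟩
  have e : quadForm ψ x y = quadForm ψ (‖x‖ • (‖x‖⁻¹ • x)) (‖y‖ • (‖y‖⁻¹ • y)) := by
    rw [smul_inv_smul₀ hx', smul_inv_smul₀ hy']
  rw [e, quadForm_smul_smul]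
  exact mul_nonneg (Complex.zero_le_real.mpr (by positivity)) hs

/-- The sphere is that of the sup norm, which the Euclidean norm dominates; hence an inequality
only. -/
theorem one_le_re_star_dotProduct_self {ι : Type*} [Fintype ι] {x : ι → ℂ}
    (hx : x ∈ Metric.sphere (0 : ι → ℂ) 1) : 1 ≤ (star x ⬝ᵥ x).re := by
  have hx1 : ‖x‖ = 1 := by simpa using hx
  have e : (star x ⬝ᵥ x).re = ∑ i, ‖x i‖ ^ 2 := by
    simp [dotProduct, Complex.sq_norm, Complex.normSq_apply]
  rw [e]
  by_contra! hlt
  have : ‖x‖ < 1 := by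
    refine (pi_norm_lt_iff one_pos).mpr fun i => ?_
    have := (Finset.single_le_sum (fun j _ => sq_nonneg ‖x j‖) (Finset.mem_univ i)).trans_lt hlt
    exact (sq_lt_one_iff₀ (norm_nonneg _)).mp this
  exact this.ne hx1

/-- A positive map whose quadratic form vanishes wherever that of `φ` does is orthogonal to the
dual face of `φ`. -/
theorem pairing_eq_zero_of_quadForm {m n : ℕ} {φ ψ : MatrixMap m n} (hφ : IsPositiveMap φ)
    (hψ : IsPositiveMap ψ) (h : ∀ x y, quadForm φ x y = 0 → quadForm ψ x y = 0)
    {A : BiMatrix n m} (hA : A ∈ dualFace (positiveCone m n) (ray φ)) : pairing A ψ = 0 := by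
  have hre : ∀ {χ : MatrixMap m n}, IsPositiveMap χ → ∀ x y,
      quadForm χ x y = ((quadForm χ x y).re : ℂ) := fun hχ x y =>
    Complex.eq_re_of_ofReal_le (r := 0) (by simpa using hχ.quadForm_nonneg x y)
  have hφA : pairing A φ = 0 := hA.2 φ ⟨1, zero_le_one, (one_smul ℝ φ).symm⟩
  have bound : ∀ ε : ℝ, 0 < ε → (pairing A ψ).re ≤ ε * A.trace.re := by
    intro ε hε
    obtain ⟨C, hC0, hC⟩ := exists_mul_bound_of_isCompact
      (((isCompact_sphere (0 : Fin m → ℂ) 1).prod (isCompact_sphere (0 : Fin n → ℂ) 1)))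
      (f := fun p => (quadForm φ p.1 p.2).re) (g := fun p => (quadForm ψ p.1 p.2).re)
      (Complex.continuous_re.comp (continuous_quadForm φ))
      (Complex.continuous_re.comp (continuous_quadForm ψ))
      (fun p _ => (Complex.nonneg_iff.mp (hφ.quadForm_nonneg p.1 p.2)).1)
      (fun p _ h0 => by
        rw [h p.1 p.2 (by rw [hre hφ, h0, Complex.ofReal_zero]), Complex.zero_re]) hε
    -- On unit pairs the form of `traceMap` is at least `1`, so `ε • traceMap m n` absorbs the error
    -- `ε`. As `A` annihilates `φ`, pairing with `A` leaves only `ε Tr A`.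
    have hpos : IsPositiveMap (C • φ + ε • traceMap m n - ψ) := by
      refine isPositiveMap_of_sphere fun p hp => ?_
      have h1 := one_le_re_star_dotProduct_self hp.1
      have h2 := one_le_re_star_dotProduct_self hp.2
      have e : ∀ {k : ℕ} (x : Fin k → ℂ), star x ⬝ᵥ x = ((star x ⬝ᵥ x).re : ℂ) := fun x =>
        Complex.eq_re_of_ofReal_le (r := 0) (by simp)
      rw [quadForm_sub, quadForm_add, quadForm_smul, quadForm_smul, quadForm_traceMap,
        hre hφ, hre hψ, dotProduct_comm p.1, e p.1, e p.2]
      have := hC p hp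
      have h3 : 1 ≤ (star p.1 ⬝ᵥ p.1).re * (star p.2 ⬝ᵥ p.2).re := by nlinarith
      norm_cast
      nlinarith
    have := (Complex.nonneg_iff.mp (hA.1 _ hpos)).1
    rw [pairing_sub_right, pairing_add_right, pairing_smul_right, pairing_smul_right, hφA,
      pairing_traceMap] at this
    simp at this
    linarith
  have h0 := hA.1 ψ hψ
  have h1 : (pairing A ψ).re ≤ 0 := by
    have ht : Tendsto (fun ε : ℝ => ε * A.trace.re) (𝓝[>] 0) (𝓝 0) := by
      have : Tendsto (fun ε : ℝ => ε * A.trace.re) (𝓝 0) (𝓝 (0 * A.trace.re)) :=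
        (continuous_id.mul continuous_const).tendsto 0
      rw [zero_mul] at this
      exact this.mono_left nhdsWithin_le_nhds
    exact ge_of_tendsto ht (eventually_mem_nhdsWithin.mono fun ε hε => bound ε hε)
  rw [Complex.nonneg_iff] at h0
  exact Complex.ext (le_antisymm h1 h0.1) h0.2.symm

/-! ### Dual faces and their relative interiors -/

theorem zero_mem_dualFace {m n : ℕ} (C F : Set (MatrixMap m n)) :
    (0 : BiMatrix n m) ∈ dualFace C F := by
  constructor <;> intro ψ _ <;> simp [pairing]

theorem convex_dualFace {m n : ℕ} (C F : Set (MatrixMap m n)) : Convex ℝ (dualFace C F) := by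
  intro A hA B hB a b ha hb _
  constructor
  · intro ψ hψ
    rw [pairing_add_left, pairing_smul_left, pairing_smul_left]
    exact add_nonneg (mul_nonneg (Complex.zero_le_real.mpr ha) (hA.1 ψ hψ))
      (mul_nonneg (Complex.zero_le_real.mpr hb) (hB.1 ψ hψ))
  · intro ψ hψ
    rw [pairing_add_left, pairing_smul_left, pairing_smul_left, hA.2 ψ hψ, hB.2 ψ hψ]
    simp

theorem intrinsicInterior_dualFace_nonempty {m n : ℕ} (C F : Set (MatrixMap m n)) :
    (intrinsicInterior ℝ (dualFace C F)).Nonempty := by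
  -- A norm is chosen only to apply the finite-dimensional existence theorem.
  let _ : NormedAddCommGroup (BiMatrix n m) := Matrix.normedAddCommGroup
  let _ : NormedSpace ℝ (BiMatrix n m) := Matrix.normedSpace
  exact Set.Nonempty.intrinsicInterior (convex_dualFace C F) ⟨0, zero_mem_dualFace C F⟩

/-- An element of the cone orthogonal to a relative interior point of a dual face is orthogonal
to the whole face. -/
theorem pairing_eq_zero_of_mem_intrinsicInterior {m n : ℕ} {C F : Set (MatrixMap m n)}
    {A B : BiMatrix n m} {ψ : MatrixMap m n} (hA : A ∈ intrinsicInterior ℝ (dualFace C F))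
    (hB : B ∈ dualFace C F) (hψ : ψ ∈ C) (h : pairing A ψ = 0) : pairing B ψ = 0 := by
  obtain ⟨ε, hε, hmem⟩ := exists_prolong_of_mem_intrinsicInterior hA hB
  -- The prolonged point pairs with `ψ` to `-ε ⟨B, ψ⟩`, which must be non-negative.
  have h1 := hmem.1 ψ hψ
  rw [pairing_add_left, pairing_smul_left, pairing_sub_left, h, zero_add, zero_sub, mul_neg,
    neg_nonneg] at h1
  have h2 := mul_nonneg (Complex.zero_le_real.mpr hε.le) (hB.1 ψ hψ)
  exact (mul_eq_zero.mp (le_antisymm h1 h2)).resolve_left (by exact_mod_cast hε.ne')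

theorem posDef_of_posSemidef_of_ker {ι : Type*} [Fintype ι] {A : Matrix ι ι ℂ}
    (hA : A.PosSemidef) (h : ∀ w, star w ⬝ᵥ (A *ᵥ w) = 0 → w = 0) : A.PosDef :=
  .of_dotProduct_mulVec_pos hA.1 fun w hw =>
    (hA.dotProduct_mulVec_nonneg w).lt_of_ne' fun h0 => hw (h w h0)

theorem eq_zero_of_posDef {ι : Type*} [Fintype ι] {A : Matrix ι ι ℂ}
    (hA : A.PosDef) {w : ι → ℂ} (h : star w ⬝ᵥ (A *ᵥ w) = 0) : w = 0 := by
  by_contra hw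
  exact (hA.dotProduct_mulVec_pos hw).ne' h

/-- A dual face of the cone of positive maps lies in the interior of `𝕋` if and only if it is
orthogonal to no nonzero `X ↦ V* X V` and to no nonzero `X ↦ V* Xᵗ V`. -/
theorem liesInInterior_dualFace_iff {m n : ℕ} (F : Set (MatrixMap m n)) :
    LiesInInterior (dualFace (positiveCone m n) F) (pptCone n m) ↔
      (∀ w, (∀ B ∈ dualFace (positiveCone m n) F, pairing B (conjMap (unvec w)) = 0) → w = 0) ∧
      (∀ w, (∀ B ∈ dualFace (positiveCone m n) F, pairing B (coconjMap (unvec w)) = 0) →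
        w = 0) := by
  constructor
  · intro h
    obtain ⟨A, hA⟩ := intrinsicInterior_dualFace_nonempty (positiveCone m n) F
    have hA' := intrinsicInterior_subset hA
    obtain ⟨h1, h2⟩ := mem_intrinsicInterior_pptCone.mp (h hA)
    exact ⟨fun w hw => eq_zero_of_posDef h1 (by rw [← pairing_conjMap, hw A hA']),
      fun w hw => eq_zero_of_posDef h2 (by rw [← pairing_coconjMap, hw A hA'])⟩
  · rintro ⟨h1, h2⟩ A hA
    have hT := dualCone_subset_pptCone (intrinsicInterior_subset hA).1
    refine mem_intrinsicInterior_pptCone.mpr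
      ⟨posDef_of_posSemidef_of_ker hT.1 fun w hw => h1 w fun B hB => ?_,
        posDef_of_posSemidef_of_ker hT.2 fun w hw => h2 w fun B hB => ?_⟩
    · exact pairing_eq_zero_of_mem_intrinsicInterior hA hB (isPositiveMap_conjMap _)
        (by rw [pairing_conjMap, hw])
    · exact pairing_eq_zero_of_mem_intrinsicInterior hA hB (isPositiveMap_coconjMap _)
        (by rw [pairing_coconjMap, hw])

/-! ### The spanning criterion -/

theorem span_eq_top_iff_forall_star_dotProduct {ι : Type*} [Fintype ι] (S : Set (ι → ℂ)) :
    Submodule.span ℂ S = ⊤ ↔ ∀ w : ι → ℂ, (∀ z ∈ S, star w ⬝ᵥ z = 0) → w = 0 := by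
  classical
  constructor
  · intro h w hw
    have hle : Submodule.span ℂ S ≤ LinearMap.ker (dotProductBilin ℂ ℂ (star w)) :=
      Submodule.span_le.mpr fun z hz => hw z hz
    rw [h] at hle
    exact dotProduct_star_self_eq_zero.mp
      (hle (Submodule.mem_top (x := w)))
  · intro h
    by_contra hne
    obtain ⟨f, hf, hle⟩ := Submodule.exists_le_ker_of_lt_top _ (lt_top_iff_ne_top.mpr hne)
    have hfz : ∀ z, f z = (fun i => f (Pi.single i 1)) ⬝ᵥ z := fun z => by
      conv_lhs => rw [pi_eq_sum_univ' z]
      simp [dotProduct, map_sum, mul_comm]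
    have h0 := h (star fun i => f (Pi.single i 1)) fun z hz => by
      rw [star_star, ← hfz]
      exact hle (Submodule.subset_span hz)
    refine hf (LinearMap.ext fun z => ?_)
    rw [hfz, star_eq_zero.mp h0]
    simp

theorem forall_pairing_conjMap_eq_zero_iff {m n : ℕ} {φ : MatrixMap m n} (hφ : IsPositiveMap φ)
    (w : Fin n × Fin m → ℂ) :
    (∀ B ∈ dualFace (positiveCone m n) (ray φ), pairing B (conjMap (unvec w)) = 0) ↔
      ∀ z ∈ productZeros φ, star w ⬝ᵥ z = 0 := by
  constructor
  · rintro h _ ⟨x, y, hxy, rfl⟩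
    have := h _ (vecMulVec_mem_dualFace hxy)
    rw [pairing_vecMulVec, quadForm_conjMap] at this
    exact Complex.normSq_eq_zero.mp (by exact_mod_cast this)
  · intro h B hB
    refine pairing_eq_zero_of_quadForm hφ (isPositiveMap_conjMap _) (fun x y hxy => ?_) hB
    rw [quadForm_conjMap, h _ ⟨x, y, hxy, rfl⟩]
    simp

theorem forall_pairing_coconjMap_eq_zero_iff {m n : ℕ} {φ : MatrixMap m n} (hφ : IsPositiveMap φ)
    (w : Fin n × Fin m → ℂ) :
    (∀ B ∈ dualFace (positiveCone m n) (ray φ), pairing B (coconjMap (unvec w)) = 0) ↔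
      ∀ z ∈ productZerosConj φ, star w ⬝ᵥ z = 0 := by
  constructor
  · rintro h _ ⟨x, y, hxy, rfl⟩
    have := h _ (vecMulVec_mem_dualFace ((mem_productZeros_iff x y).mp hxy))
    rw [pairing_vecMulVec, quadForm_coconjMap] at this
    exact Complex.normSq_eq_zero.mp (by exact_mod_cast this)
  · intro h B hB
    refine pairing_eq_zero_of_quadForm hφ (isPositiveMap_coconjMap _) (fun x y hxy => ?_) hB
    rw [quadForm_coconjMap, h _ ⟨x, y, (mem_productZeros_iff x y).mpr hxy, rfl⟩]
    simp

/-! ### The bidual face of an exposed map -/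

/-- A real functional is given on hermitian matrices by a complex coefficient matrix. -/
theorem exists_coeff_of_real_functional {ι : Type*} [Fintype ι] [DecidableEq ι]
    (g : Matrix ι ι ℂ →ₗ[ℝ] ℝ) :
    ∃ A : Matrix ι ι ℂ, ∀ c : Matrix ι ι ℂ, c.IsHermitian →
      ∑ p, ∑ q, A p q * c p q = (g c : ℂ) := by
  let f : Matrix ι ι ℂ →ₗ[ℂ] ℂ := Module.Dual.extendRCLike (𝕜 := ℂ) g
  have hf : ∀ c, f c = ∑ p, ∑ q, c p q * f (Matrix.single p q 1) := fun c => by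
    conv_lhs => rw [Matrix.matrix_eq_sum_single c]
    simp only [map_sum]
    refine Finset.sum_congr rfl fun p _ => Finset.sum_congr rfl fun q _ => ?_
    rw [← smul_eq_mul, ← map_smul, Matrix.smul_single, smul_eq_mul, mul_one]
  -- Hermitian symmetrisation of the coefficients of `f`: on hermitian `c` it yields `(f c + star (f
  -- c)) / 2 = Re (f c) = g c`.
  refine ⟨Matrix.of fun p q =>
    (f (Matrix.single p q 1) + star (f (Matrix.single q p 1))) / 2, fun c hc => ?_⟩
  have hstar : star (f c) = ∑ p, ∑ q, c p q * star (f (Matrix.single q p 1)) := by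
    rw [hf c]
    simp only [star_sum, star_mul']
    rw [Finset.sum_comm]
    refine Finset.sum_congr rfl fun p _ => Finset.sum_congr rfl fun q _ => ?_
    rw [hc.apply]
  have e : ∑ p, ∑ q, Matrix.of (fun p q =>
      (f (Matrix.single p q 1) + star (f (Matrix.single q p 1))) / 2) p q * c p q
      = (f c + star (f c)) / 2 := by
    rw [hstar, hf c, ← Finset.sum_add_distrib, Finset.sum_div]
    refine Finset.sum_congr rfl fun p _ => ?_
    rw [← Finset.sum_add_distrib, Finset.sum_div]
    refine Finset.sum_congr rfl fun q _ => ?_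
    rw [Matrix.of_apply]
    ring
  have hre : (f c).re = g c := Module.Dual.re_extendRCLike_apply (𝕜 := ℂ) g c
  rw [e, ← hre, Complex.star_def, Complex.add_conj]
  push_cast
  ring

/-- The matrix of coefficients `φ(e_{kl})_{ij}`. -/
def choi {m n : ℕ} (φ : MatrixMap m n) : BiMatrix n m :=
  Matrix.of fun p q => φ (Matrix.single p.2 q.2 1) p.1 q.1

/-- The map with a given matrix of coefficients. -/
def ofChoi (m n : ℕ) : BiMatrix n m →ₗ[ℝ] MatrixMap m n where
  toFun c :=
    { toFun := fun X => Matrix.of fun i j => ∑ k, ∑ l, X k l * c (i, k) (j, l)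
      map_add' := fun X Y => by
        ext i j
        simp [add_mul, Finset.sum_add_distrib]
      map_smul' := fun a X => by
        ext i j
        simp [Finset.mul_sum, mul_assoc] }
  map_add' c d := by
    ext X i j
    simp [mul_add, Finset.sum_add_distrib]
  map_smul' a c := by
    ext X i j
    simp [Finset.mul_sum, mul_left_comm]

theorem ofChoi_choi {m n : ℕ} (φ : MatrixMap m n) : ofChoi m n (choi φ) = φ := by
  refine LinearMap.ext fun X => ?_
  conv_rhs => rw [Matrix.matrix_eq_sum_single X]
  ext i j
  simp only [ofChoi, choi, LinearMap.coe_mk, AddHom.coe_mk, Matrix.of_apply, map_sum,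
    Matrix.sum_apply]
  refine Finset.sum_congr rfl fun k _ => Finset.sum_congr rfl fun l _ => ?_
  rw [← smul_eq_mul, ← Matrix.smul_apply, ← map_smul, Matrix.smul_single, smul_eq_mul, mul_one]

theorem pairing_eq_sum_choi {m n : ℕ} (A : BiMatrix n m) (φ : MatrixMap m n) :
    pairing A φ = ∑ p, ∑ q, A p q * choi φ p q := by
  simp only [pairing, choi, Fintype.sum_prod_type, Matrix.of_apply]
  refine Finset.sum_congr rfl fun i _ => ?_
  rw [Finset.sum_comm]

open scoped MatrixOrder Matrix.Norms.L2Operator in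
/-- Positive maps preserve adjoints. -/
theorem IsPositiveMap.map_conjTranspose {m n : ℕ} {φ : MatrixMap m n} (hφ : IsPositiveMap φ)
    (X : Matrix (Fin m) (Fin m) ℂ) : φ Xᴴ = (φ X)ᴴ := by
  have hX : X ∈ Submodule.span ℂ {a : Matrix (Fin m) (Fin m) ℂ | 0 ≤ a} := by
    rw [CStarAlgebra.span_nonneg]
    trivial
  induction hX using Submodule.span_induction with
  | mem x h =>
    have hx : x.PosSemidef := Matrix.nonneg_iff_posSemidef.mp h
    rw [hx.1.eq, (hφ x hx).1.eq]
  | zero => simp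
  | add x y _ _ hx hy => simp [hx, hy]
  | smul a x _ hx => simp [hx]

theorem IsPositiveMap.isHermitian_choi {m n : ℕ} {φ : MatrixMap m n} (hφ : IsPositiveMap φ) :
    (choi φ).IsHermitian := by
  ext p q
  have h := hφ.map_conjTranspose (Matrix.single q.2 p.2 1)
  rw [Matrix.conjTranspose_single, star_one] at h
  simp only [choi, Matrix.conjTranspose_apply, Matrix.of_apply]
  rw [h, Matrix.conjTranspose_apply]

/-- Positive maps have hermitian coefficient matrices, where a real functional is a complex pairing.
-/
theorem exists_pairing_eq_of_real_functional {m n : ℕ} (f : MatrixMap m n →ₗ[ℝ] ℝ) :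
    ∃ A : BiMatrix n m, ∀ ψ, IsPositiveMap ψ → pairing A ψ = f ψ := by
  obtain ⟨A, hA⟩ := exists_coeff_of_real_functional (f ∘ₗ ofChoi m n)
  refine ⟨A, fun ψ hψ => ?_⟩
  rw [pairing_eq_sum_choi, hA _ hψ.isHermitian_choi, LinearMap.comp_apply, ofChoi_choi]

/-- For exposed `φ`, the ray of `φ` is the bidual face. -/
theorem IsExposedMap.mem_ray {m n : ℕ} {φ ψ : MatrixMap m n} (hφ : IsExposedMap φ)
    (hψ : IsPositiveMap ψ)
    (h : ∀ B ∈ dualFace (positiveCone m n) (ray φ), pairing B ψ = 0) : ψ ∈ ray φ := by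
  obtain ⟨-, -, f, hf, hz⟩ := hφ
  obtain ⟨A, hA⟩ := exists_pairing_eq_of_real_functional f
  rw [← hz]
  refine ⟨hψ, ?_⟩
  -- The matrix representing the exposing functional itself belongs to the dual face.
  have hmem : A ∈ dualFace (positiveCone m n) (ray φ) := by
    refine ⟨fun χ hχ => ?_, fun χ hχ => ?_⟩
    · rw [hA χ hχ]
      exact Complex.zero_le_real.mpr (hf χ hχ)
    · rw [← hz] at hχ
      rw [hA χ hχ.1, hχ.2, Complex.ofReal_zero]
  have := h A hmem
  rw [hA ψ hψ] at this
  exact_mod_cast this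

/-! ### Decomposability -/

theorem conjMap_smul {m n : ℕ} (r : ℝ) (V : Matrix (Fin m) (Fin n) ℂ) :
    conjMap (r • V) = r ^ 2 • conjMap V := by
  refine LinearMap.ext fun X => ?_
  simp [conjMap, smul_smul, pow_two]

theorem coconjMap_smul {m n : ℕ} (r : ℝ) (V : Matrix (Fin m) (Fin n) ℂ) :
    coconjMap (r • V) = r ^ 2 • coconjMap V := by
  refine LinearMap.ext fun X => ?_
  simp [coconjMap, smul_smul, pow_two]

theorem eq_zero_of_conjMap_eq_zero {m n : ℕ} {w : Fin n × Fin m → ℂ}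
    (h : conjMap (unvec w) = 0) : w = 0 :=
  eq_zero_of_posDef Matrix.PosDef.one (by rw [← pairing_conjMap, h, pairing_zero_right])

theorem eq_zero_of_coconjMap_eq_zero {m n : ℕ} {w : Fin n × Fin m → ℂ}
    (h : coconjMap (unvec w) = 0) : w = 0 :=
  eq_zero_of_posDef Matrix.PosDef.one
    (by rw [← partialTranspose_one, ← pairing_coconjMap, h, pairing_zero_right])

/-- If a nonzero element lies on the ray of `φ`, then `φ` is a positive multiple of it. -/
theorem eq_sq_smul_of_mem_ray {E : Type*} [AddCommGroup E] [Module ℝ E] {x z : E}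
    (hz : z ∈ ray x) (h0 : z ≠ 0) : ∃ r : ℝ, x = r ^ 2 • z := by
  obtain ⟨c, hc, rfl⟩ := hz
  have hc0 : c ≠ 0 := by
    rintro rfl
    exact h0 (zero_smul ℝ x)
  exact ⟨√c⁻¹, by rw [Real.sq_sqrt (inv_nonneg.mpr hc), inv_smul_smul₀ hc0]⟩

theorem isDecomposable_conjMap {m n : ℕ} (V : Matrix (Fin m) (Fin n) ℂ) :
    IsDecomposable (conjMap V) :=
  ⟨1, 0, fun _ => V, Fin.elim0, by simp⟩

theorem isDecomposable_coconjMap {m n : ℕ} (V : Matrix (Fin m) (Fin n) ℂ) :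
    IsDecomposable (coconjMap V) :=
  ⟨0, 1, Fin.elim0, fun _ => V, by simp⟩

theorem unvec_surjective {m n : ℕ} (V : Matrix (Fin m) (Fin n) ℂ) :
    ∃ w : Fin n × Fin m → ℂ, unvec w = V :=
  ⟨fun p => V p.2 p.1, rfl⟩

/-- The dual face of a nonzero decomposable map does not lie in the interior of `𝕋`. -/
theorem IsDecomposable.eq_zero_of_liesInInterior {m n : ℕ} {φ : MatrixMap m n}
    (hφ : IsDecomposable φ)
    (h : LiesInInterior (dualFace (positiveCone m n) (ray φ)) (pptCone n m)) : φ = 0 := by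
  obtain ⟨h1, h2⟩ := (liesInInterior_dualFace_iff _).mp h
  obtain ⟨r, s, V, W, e⟩ := hφ
  have key : ∀ B ∈ dualFace (positiveCone m n) (ray φ),
      (∀ i, pairing B (conjMap (V i)) = 0) ∧ ∀ j, pairing B (coconjMap (W j)) = 0 := by
    intro B hB
    have hV : ∀ i ∈ Finset.univ, 0 ≤ pairing B (conjMap (V i)) := fun i _ =>
      hB.1 _ (isPositiveMap_conjMap _)
    have hW : ∀ j ∈ Finset.univ, 0 ≤ pairing B (coconjMap (W j)) := fun j _ =>
      hB.1 _ (isPositiveMap_coconjMap _)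
    have h0 : pairing B φ = 0 := hB.2 φ ⟨1, zero_le_one, (one_smul ℝ φ).symm⟩
    -- Non-negative terms with sum zero vanish one by one.
    rw [e, pairing_add_right, pairing_sum_right, pairing_sum_right,
      add_eq_zero_iff_of_nonneg (Finset.sum_nonneg hV) (Finset.sum_nonneg hW),
      Finset.sum_eq_zero_iff_of_nonneg hV, Finset.sum_eq_zero_iff_of_nonneg hW] at h0
    exact ⟨fun i => h0.1 i (Finset.mem_univ i), fun j => h0.2 j (Finset.mem_univ j)⟩
  have hV : ∀ i, conjMap (V i) = 0 := fun i => by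
    obtain ⟨w, hw⟩ := unvec_surjective (V i)
    rw [← hw, h1 w fun B hB => by rw [hw]; exact (key B hB).1 i]
    ext X
    simp [conjMap, unvec, Matrix.mul_apply]
  have hW : ∀ j, coconjMap (W j) = 0 := fun j => by
    obtain ⟨w, hw⟩ := unvec_surjective (W j)
    rw [← hw, h2 w fun B hB => by rw [hw]; exact (key B hB).2 j]
    ext X
    simp [coconjMap, unvec, Matrix.mul_apply]
  rw [e]
  simp [hV, hW]

/-- A nonzero elementary map orthogonal to the face lies on the ray of `φ`, so `φ` is `r ^ 2` times
it; the factor `r` goes into `V`. -/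
theorem IsExposedMap.liesInInterior_of_not_isDecomposable {m n : ℕ} {φ : MatrixMap m n}
    (hφ : IsExposedMap φ) (h : ¬ IsDecomposable φ) :
    LiesInInterior (dualFace (positiveCone m n) (ray φ)) (pptCone n m) := by
  refine (liesInInterior_dualFace_iff _).mpr ⟨fun w hw => ?_, fun w hw => ?_⟩ <;> by_contra hw0
  · obtain ⟨r, e⟩ := eq_sq_smul_of_mem_ray (hφ.mem_ray (isPositiveMap_conjMap _) hw)
      fun h0 => hw0 (eq_zero_of_conjMap_eq_zero h0)
    rw [← conjMap_smul] at e
    exact h (e ▸ isDecomposable_conjMap _)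
  · obtain ⟨r, e⟩ := eq_sq_smul_of_mem_ray (hφ.mem_ray (isPositiveMap_coconjMap _) hw)
      fun h0 => hw0 (eq_zero_of_coconjMap_eq_zero h0)
    rw [← coconjMap_smul] at e
    exact h (e ▸ isDecomposable_coconjMap _)

end PPTFace

theorem mainTheorem3 (m n : ℕ) (φ : MatrixMap m n) (hφ : IsPositiveMap φ) :
    (LiesInInterior (dualFace (positiveCone m n) (ray φ)) (pptCone n m) ↔
      Submodule.span ℂ (productZeros φ) = ⊤ ∧ Submodule.span ℂ (productZerosConj φ) = ⊤) ∧
    (IsExposedMap φ →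
      (LiesInInterior (dualFace (positiveCone m n) (ray φ)) (pptCone n m) ↔
        IsIndecomposable φ)) := by
  refine ⟨?_, fun hex => ⟨fun h => ⟨hφ, fun hd => hex.2.1 (hd.eq_zero_of_liesInInterior h)⟩,
    fun h => hex.liesInInterior_of_not_isDecomposable h.2⟩⟩
  rw [liesInInterior_dualFace_iff, span_eq_top_iff_forall_star_dotProduct,
    span_eq_top_iff_forall_star_dotProduct]
  simp only [forall_pairing_conjMap_eq_zero_iff hφ, forall_pairing_coconjMap_eq_zero_iff hφ]
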